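/- **Theorem (Approximation in norm).** Let $\mathcal X$ be a measurable space and let $k\colon\mathcal X\times\mathcal X\to\mathbb R$ be a symmetric, positive (semi)definite, bounded and jointly measurable kernel (for instance a bounded continuous kernel on a second countable space with its Borel $\sigma$-algebra), with reproducing kernel Hilbert space $(\mathcal H_k,\|\cdot\|_k)$. Let $\rho$ be a probability measure on $\mathcal X\times\mathbb R$, let $(X,f)\sim\rho$ with $\mathbb E f^2<\infty$, and let $P=\rho(\cdot\times\mathbb R)$ be the law of $X$. Write $f_0(x)=\mathbb E(f\mid X=x)$ and $\operatorname{var}(f\mid x)=\mathbb E\big((f-f_0(X))^2\mid X=x\big)$. For $\lambda>0$ the functional $$g\mapsto \mathbb E\big(f-g(X)\big)^2+\lambda\|g\|_k^2,\qquad g\in\mathcal H_k,$$ has a unique minimizer $f_\lambda\in\mathcal H_k$. For $n\ge1$ and independent observations $(X_j,f_j)\sim\rho$, $j=1,\dots,n$, define the auxiliary estimator $$\tilde f_n=\frac1n\sum_{j=1}^n k(\cdot,X_j)\,\frac{f_j-f_\lambda(X_j)}{\lambda}\in\mathcal H_k .$$ Then, for all $\lambda>0$ and $n\ge1$, $\|f_\lambda-\tilde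 f_n\|_k^2$ is integrable and $$\mathbb E\|f_\lambda-\tilde f_n\|_k^2=\frac1{\lambda^2 n}\int_{\mathcal X}\Big(\operatorname{var}(f\mid x)+\big(f_0(x)-f_\lambda(x)\big)^2\Big)k(x,x)\,P(dx)-\frac1n\|f_\lambda\|_k^2 .$$ Consequently it is of order $\frac{1}{\lambda^2 n}$, in the following sense: there are a function $C_1$ of $\lambda$ alone and a constant $C>0$, both depending only on $k$ and $\rho$ (and $C$ independent of $\lambda$ and $n$), such that for all $\lambda>0$ and $n\ge1$ $$\mathbb E\|f_\lambda-\tilde f_n\|_k^2=\frac{C_1(\lambda)}{\lambda^2 n},\qquad \int_{\mathcal X}\operatorname{var}(f\mid x)\,k(x,x)\,P(dx)\le C_1(\lambda)\le C .$$ -/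

import Mathlib

open MeasureTheory ProbabilityTheory

/-- A kernel on `𝒳`: a symmetric, positive (semi)definite real function of two variables. -/
structure PDKernel (𝒳 : Type*) where
  /-- The underlying function `(x, y) ↦ k(x, y)`. -/
  toFun : 𝒳 → 𝒳 → ℝ
  symm : ∀ x y, toFun x y = toFun y x
  nonneg : ∀ c : 𝒳 →₀ ℝ, 0 ≤ c.sum fun x a => c.sum fun y b => a * b * toFun x y

namespace PDKernel

variable {𝒳 : Type*}

instance instCoeFun : CoeFun (PDKernel 𝒳) (fun _ => 𝒳 → 𝒳 → ℝ) := ⟨PDKernel.toFun⟩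

/-- The kernel, each value being viewed as multiplication by a scalar on `ℝ`. -/
noncomputable def matrix (k : PDKernel 𝒳) : Matrix 𝒳 𝒳 (ℝ →L[ℝ] ℝ) :=
  Matrix.of fun x y => k x y • ContinuousLinearMap.id ℝ ℝ

theorem matrix_apply (k : PDKernel 𝒳) (x y : 𝒳) (v : ℝ) : k.matrix x y v = k x y * v := by
  simp [matrix]

theorem posSemidef_matrix (k : PDKernel 𝒳) : k.matrix.PosSemidef := by
  have h := (RKHS.posSemidef_tfae (K := k.matrix)).out 0 2
  refine h.mpr ⟨?_, fun c => ?_⟩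
  · ext x y
    have h1 : star (ContinuousLinearMap.id ℝ ℝ) = ContinuousLinearMap.id ℝ ℝ :=
      star_one (ℝ →L[ℝ] ℝ)
    simp [Matrix.conjTranspose_apply, matrix, k.symm x y, h1]
  · refine (k.nonneg c).trans_eq ?_
    simp only [matrix_apply, Finsupp.sum, RCLike.re_to_real]
    refine Finset.sum_congr rfl fun x _ => Finset.sum_congr rfl fun y _ => ?_
    simp [k.symm x y]
    ring

instance instFact (k : PDKernel 𝒳) : Fact k.matrix.PosSemidef := ⟨k.posSemidef_matrix⟩

/-- The reproducing kernel Hilbert space `H_k`: the completion of the span of the functions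
`k(·, x)` for the inner product with `⟪k(·, x), k(·, y)⟫ = k(x, y)`. -/
abbrev Space (k : PDKernel 𝒳) := RKHS.OfKernel k.matrix

/-- The function `k(·, x)` as an element of `H_k`. -/
noncomputable def section_ (k : PDKernel 𝒳) (x : 𝒳) : k.Space :=
  RKHS.kerFun k.Space x (1 : ℝ)

theorem section_apply (k : PDKernel 𝒳) (x y : 𝒳) : k.section_ y x = k x y := by
  rw [section_, RKHS.kerFun_apply, RKHS.OfKernel.kernel_ofKernel, matrix_apply, mul_one]

theorem inner_section (k : PDKernel 𝒳) (x : 𝒳) (g : k.Space) :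
    inner ℝ (k.section_ x) g = g x := by
  simp [section_]

theorem inner_section_section (k : PDKernel 𝒳) (x y : 𝒳) :
    inner ℝ (k.section_ x) (k.section_ y) = k x y := by
  rw [inner_section, section_apply]

end PDKernel

namespace KernelRegression

variable {𝒳 : Type*} [MeasurableSpace 𝒳]

/-- The design measure `P(·) = ρ(· × ℝ)`. -/
noncomputable def design (ρ : Measure (𝒳 × ℝ)) : Measure 𝒳 := ρ.fst

/-- The conditional expectation `f₀(x) = E(f | X = x)`, the mean of the disintegration
`ρ(· | x)` of the joint law `ρ` of `(X, f)`. -/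
noncomputable def condMean (ρ : Measure (𝒳 × ℝ)) [IsFiniteMeasure ρ] (x : 𝒳) : ℝ :=
  ∫ y, y ∂(ρ.condKernel x)

/-- The conditional variance `var(f | x) = E((f - f₀(X))² | X = x)`. -/
noncomputable def condVar (ρ : Measure (𝒳 × ℝ)) [IsFiniteMeasure ρ] (x : 𝒳) : ℝ :=
  ∫ y, (y - condMean ρ x) ^ 2 ∂(ρ.condKernel x)

/-- The regularized objective `g ↦ E(f - g(X))² + lam ‖g‖_k²` on `H_k`. -/
noncomputable def objective (k : PDKernel 𝒳) (ρ : Measure (𝒳 × ℝ)) (lam : ℝ)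
    (g : k.Space) : ℝ :=
  (∫ z, (z.2 - g z.1) ^ 2 ∂ρ) + lam * ‖g‖ ^ 2

/-- `g` is the solution `f_lam` of the continuous problem: it minimizes the regularized
objective over the whole of `H_k`. -/
def IsSolution (k : PDKernel 𝒳) (ρ : Measure (𝒳 × ℝ)) (lam : ℝ) (g : k.Space) : Prop :=
  ∀ h : k.Space, objective k ρ lam g ≤ objective k ρ lam h

/-- The auxiliary estimator `(1/n) ∑ⱼ w̃ⱼ k(·, xⱼ)`, `w̃ⱼ = (yⱼ - f_lam(xⱼ)) / lam`, at the
data `(xⱼ, yⱼ)`, as an element of `H_k`. -/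
noncomputable def auxEstimator (k : PDKernel 𝒳) (lam : ℝ) (flam : k.Space) {n : ℕ}
    (x : Fin n → 𝒳) (y : Fin n → ℝ) : k.Space :=
  (1 / (n : ℝ)) • ∑ j, ((y j - flam (x j)) / lam) • k.section_ (x j)

end KernelRegression

/-! The minimizer is characterized by the normal equations `E((f - g(X)) h(X)) = lam ⟪g, h⟫`, which
say that `k(·, X) (f - g(X)) / lam` has mean `g` in `H_k`. The auxiliary estimator is thus an
average of `n` i.i.d. vectors with mean `f_lam`, and its mean squared error is `1/n` times the
second moment of one summand minus `‖f_lam‖²`. That second moment is `lam⁻² E((f - f_lam(X))² k(X,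
X))`; conditioning on `X` splits it into variance and squared bias.

Vector-valued integrals are avoided: the squared norm is expanded by the reproducing property, and
the normal equations are tested on kernel sections and on `f_lam` itself
(`NormalEquations.integrable_prod`). For the order, the lower bound is Jensen's inequality in `H_k`
(`NormalEquations.sq_mul_norm_sq_le`), and the upper bound compares `f_lam` with the zero function.
-/

namespace PDKernel

/-! ### Evaluation, measurability and norms in `H_k`. -/

variable {𝒳 : Type*} (k : PDKernel 𝒳)

theorem norm_section_sq (x : 𝒳) : ‖k.section_ x‖ ^ 2 = k x x := by
  rw [← real_inner_self_eq_norm_sq, inner_section_section]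

theorem diag_nonneg (x : 𝒳) : 0 ≤ k x x := by
  rw [← norm_section_sq]; positivity

variable {k}

theorem abs_apply_le {B : ℝ} (hB : ∀ x y, |k x y| ≤ B) (g : k.Space) (x : 𝒳) :
    |g x| ≤ √B * ‖g‖ := by
  rw [← inner_section]
  refine (abs_real_inner_le_norm _ _).trans ?_
  gcongr
  refine Real.le_sqrt_of_sq_le ?_
  rw [norm_section_sq]
  exact (le_abs_self _).trans (hB x x)

/-- The functions of `H_k` are measurable when the kernel is. -/
theorem measurable_coe [MeasurableSpace 𝒳] (hk : Measurable fun p : 𝒳 × 𝒳 => k p.1 p.2)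
    (g : k.Space) : Measurable g := by
  -- Norm limits in `H_k` are pointwise limits, so measurability passes from the dense span of the
  -- sections to all of `H_k`.
  have hg : g ∈ (Submodule.span ℝ {RKHS.kerFun k.Space x v | (x) (v)}).topologicalClosure := by
    rw [RKHS.kerFun_dense]; trivial
  rw [← SetLike.mem_coe, Submodule.topologicalClosure_coe, mem_closure_iff_seq_limit] at hg
  obtain ⟨u, hu, hlim⟩ := hg
  refine measurable_of_tendsto_metrizable (f := fun n => (u n : 𝒳 → ℝ)) (fun n => ?_) ?_
  · refine Submodule.span_induction (R := ℝ) (x := u n)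
      (p := fun (h : k.Space) _ => Measurable (h : 𝒳 → ℝ)) ?_ ?_ ?_ ?_ (hu n)
    · rintro _ ⟨x, v, rfl⟩
      have : (RKHS.kerFun k.Space x v : 𝒳 → ℝ) = fun y => k y x * v := by
        ext y
        rw [RKHS.kerFun_apply, RKHS.OfKernel.kernel_ofKernel, matrix_apply]
      rw [this]
      exact (hk.comp (measurable_id.prodMk measurable_const)).mul_const v
    · rw [RKHS.coe_zero]; exact measurable_zero
    · intro a b _ _ ha hb
      rw [RKHS.coe_add]; exact ha.add hb
    · intro c a _ ha
      rw [RKHS.coe_smul]; exact ha.const_smul c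
  · rw [tendsto_pi_nhds]
    intro x
    exact ((RKHS.continuous_eval x).tendsto g).comp hlim

/-- Reproducing property for a linear combination of kernel sections: expansion of the squared
distance to it. -/
theorem norm_sub_smul_sum_section_sq {n : ℕ} (g : k.Space) (c : ℝ) (w : Fin n → ℝ)
    (x : Fin n → 𝒳) :
    ‖g - c • ∑ j, w j • k.section_ (x j)‖ ^ 2 =
      ‖g‖ ^ 2 - 2 * c * ∑ j, w j * g (x j) +
        c ^ 2 * ∑ i, ∑ j, w i * w j * k (x i) (x j) := by
  rw [norm_sub_sq_real, inner_smul_right, inner_sum, norm_smul, mul_pow, Real.norm_eq_abs, sq_abs,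
    ← real_inner_self_eq_norm_sq (∑ j, w j • k.section_ (x j)), sum_inner]
  simp only [inner_sum, real_inner_smul_left, inner_smul_right, inner_section_section]
  congr 2
  · rw [← mul_assoc]
    congr 1
    refine Finset.sum_congr rfl fun j _ => ?_
    rw [real_inner_comm, inner_section]
  · refine Finset.sum_congr rfl fun i _ => Finset.sum_congr rfl fun j _ => ?_
    ring

end PDKernel

/-! ### The regularized problem and its normal equations. -/

namespace KernelRegression

variable {𝒳 : Type*} [MeasurableSpace 𝒳] {k : PDKernel 𝒳} {ρ : Measure (𝒳 × ℝ)}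

/-- The normal equations `E((f - g(X)) h(X)) = lam ⟪g, h⟫_k`, for all `h` in `H_k`, of the
regularized least squares problem. -/
def NormalEquations (k : PDKernel 𝒳) (ρ : Measure (𝒳 × ℝ)) (lam : ℝ) (g : k.Space) : Prop :=
  ∀ h : k.Space, ∫ z, (z.2 - g z.1) * h z.1 ∂ρ = lam * inner ℝ g h

theorem memLp_apply_fst [IsProbabilityMeasure ρ]
    (hk : Measurable fun p : 𝒳 × 𝒳 => k p.1 p.2) {B : ℝ} (hB : ∀ x y, |k x y| ≤ B)
    (g : k.Space) : MemLp (fun z : 𝒳 × ℝ => g z.1) 2 ρ :=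
  MemLp.of_bound ((k.measurable_coe hk g).comp measurable_fst).aestronglyMeasurable (√B * ‖g‖)
    (ae_of_all _ fun z => PDKernel.abs_apply_le hB g z.1)

/-- Lax–Milgram for the form `E(g(X) h(X)) + lam ⟪g, h⟫`, which is bounded because `|g x| ≤ √B ‖g‖`
and coercive with constant `lam`. -/
theorem exists_normalEquations [IsProbabilityMeasure ρ]
    (hk : Measurable fun p : 𝒳 × 𝒳 => k p.1 p.2) {B : ℝ} (hB : ∀ x y, |k x y| ≤ B)
    (hρ : MemLp (fun z : 𝒳 × ℝ => z.2) 2 ρ) {lam : ℝ} (hlam : 0 < lam) :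
    ∃ g : k.Space, NormalEquations k ρ lam g := by
  have hL := memLp_apply_fst (ρ := ρ) hk hB
  have hI : ∀ g h : k.Space, Integrable (fun z : 𝒳 × ℝ => g z.1 * h z.1) ρ :=
    fun g h => (hL g).integrable_mul (hL h)
  have hJ : ∀ h : k.Space, Integrable (fun z : 𝒳 × ℝ => z.2 * h z.1) ρ :=
    fun h => hρ.integrable_mul (hL h)
  let F : k.Space →L[ℝ] ℝ := LinearMap.mkContinuous
    { toFun := fun h => ∫ z, z.2 * h z.1 ∂ρ
      map_add' := fun g h => by
        rw [← integral_add (hJ g) (hJ h)]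
        simp [mul_add]
      map_smul' := fun c h => by
        simp only [RKHS.coe_smul, Pi.smul_apply, smul_eq_mul, RingHom.id_apply]
        rw [← integral_const_mul]
        congr 1 with z
        ring } ((∫ z, |z.2| ∂ρ) * √B) (fun h => by
      rw [mul_assoc, ← integral_mul_const]
      refine norm_integral_le_of_norm_le ((hρ.integrable one_le_two).abs.mul_const _)
        (ae_of_all _ fun z => ?_)
      rw [norm_mul, Real.norm_eq_abs, Real.norm_eq_abs]
      gcongr
      exact PDKernel.abs_apply_le hB h z.1)
  let A : k.Space →L[ℝ] k.Space →L[ℝ] ℝ := LinearMap.mkContinuous₂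
    (LinearMap.mk₂ ℝ (fun g h : k.Space => (∫ z, g z.1 * h z.1 ∂ρ) + lam * inner ℝ g h)
      (fun g g' h => by
        simp only [RKHS.coe_add, Pi.add_apply, add_mul, inner_add_left]
        rw [integral_add (hI g h) (hI g' h)]
        ring)
      (fun c g h => by
        simp only [RKHS.coe_smul, Pi.smul_apply, smul_eq_mul, real_inner_smul_left, mul_assoc]
        rw [integral_const_mul]
        ring)
      (fun g h h' => by
        simp only [RKHS.coe_add, Pi.add_apply, mul_add, inner_add_right]
        rw [integral_add (hI g h) (hI g h')]
        ring)
      (fun c g h => by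
        simp only [RKHS.coe_smul, Pi.smul_apply, smul_eq_mul, inner_smul_right, mul_left_comm _ c]
        rw [integral_const_mul]
        ring)) (√B * √B + lam) (fun g h => by
      have h1 : ‖∫ z, g z.1 * h z.1 ∂ρ‖ ≤ √B * ‖g‖ * (√B * ‖h‖) := by
        refine (norm_integral_le_of_norm_le_const (C := √B * ‖g‖ * (√B * ‖h‖))
          (ae_of_all _ fun z => ?_)).trans (by simp)
        rw [norm_mul, Real.norm_eq_abs, Real.norm_eq_abs]
        gcongr
        · exact PDKernel.abs_apply_le hB g z.1
        · exact PDKernel.abs_apply_le hB h z.1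
      have h2 : ‖lam * inner ℝ g h‖ ≤ lam * (‖g‖ * ‖h‖) := by
        rw [norm_mul, Real.norm_of_nonneg hlam.le]
        gcongr
        exact norm_inner_le_norm g h
      calc _ ≤ ‖∫ z, g z.1 * h z.1 ∂ρ‖ + ‖lam * inner ℝ g h‖ := norm_add_le _ _
        _ ≤ √B * ‖g‖ * (√B * ‖h‖) + lam * (‖g‖ * ‖h‖) := add_le_add h1 h2
        _ = _ := by ring)
  have hA : ∀ g h, A g h = (∫ z, g z.1 * h z.1 ∂ρ) + lam * inner ℝ g h := fun g h => rfl
  have hF : ∀ h, F h = ∫ z, z.2 * h z.1 ∂ρ := fun h => rfl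
  have hcoer : IsCoercive A := by
    refine ⟨lam, hlam, fun g => ?_⟩
    rw [hA, real_inner_self_eq_norm_mul_norm, mul_assoc]
    exact le_add_of_nonneg_left (integral_nonneg fun z => mul_self_nonneg _)
  refine ⟨hcoer.continuousLinearEquivOfBilin.symm ((InnerProductSpace.toDual ℝ k.Space).symm F),
    fun h => ?_⟩
  set g := hcoer.continuousLinearEquivOfBilin.symm ((InnerProductSpace.toDual ℝ k.Space).symm F)
  have h1 := hcoer.continuousLinearEquivOfBilin_apply g h
  rw [ContinuousLinearEquiv.apply_symm_apply, InnerProductSpace.toDual_symm_apply, hA, hF] at h1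
  simp only [sub_mul]
  rw [integral_sub (hJ h) (hI g h), h1]
  ring

/-- The objective is quadratic, and the normal equations cancel the part linear in `h - g`.
Minimality and uniqueness both follow from this identity. -/
theorem NormalEquations.objective_eq [IsProbabilityMeasure ρ]
    (hk : Measurable fun p : 𝒳 × 𝒳 => k p.1 p.2) {B : ℝ} (hB : ∀ x y, |k x y| ≤ B)
    (hρ : MemLp (fun z : 𝒳 × ℝ => z.2) 2 ρ) {lam : ℝ} {g : k.Space}
    (hg : NormalEquations k ρ lam g) (h : k.Space) :
    objective k ρ lam h =
      objective k ρ lam g + (∫ z, ((h - g) z.1) ^ 2 ∂ρ) + lam * ‖h - g‖ ^ 2 := by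
  have hL := memLp_apply_fst (ρ := ρ) hk hB
  have hr : MemLp (fun z : 𝒳 × ℝ => z.2 - g z.1) 2 ρ := hρ.sub (hL g)
  obtain ⟨d, rfl⟩ : ∃ d, h = g + d := ⟨h - g, by abel⟩
  have h1 : ∀ z : 𝒳 × ℝ, (z.2 - (g + d) z.1) ^ 2 =
      (z.2 - g z.1) ^ 2 - 2 * ((z.2 - g z.1) * d z.1) + (d z.1) ^ 2 := fun z => by
    rw [RKHS.coe_add, Pi.add_apply]; ring
  have h2 : Integrable (fun z : 𝒳 × ℝ => 2 * ((z.2 - g z.1) * d z.1)) ρ :=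
    (hr.integrable_mul (hL d)).const_mul 2
  simp only [objective, h1, add_sub_cancel_left]
  rw [integral_add (f := fun z : 𝒳 × ℝ => (z.2 - g z.1) ^ 2 - 2 * ((z.2 - g z.1) * d z.1))
    (hr.integrable_sq.sub h2) (hL d).integrable_sq, integral_sub hr.integrable_sq h2,
    integral_const_mul, hg d, norm_add_sq_real]
  ring

theorem NormalEquations.isSolution [IsProbabilityMeasure ρ]
    (hk : Measurable fun p : 𝒳 × 𝒳 => k p.1 p.2) {B : ℝ} (hB : ∀ x y, |k x y| ≤ B)
    (hρ : MemLp (fun z : 𝒳 × ℝ => z.2) 2 ρ) {lam : ℝ} (hlam : 0 < lam) {g : k.Space}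
    (hg : NormalEquations k ρ lam g) : IsSolution k ρ lam g := by
  intro h
  rw [hg.objective_eq hk hB hρ h, add_assoc]
  have : 0 ≤ ∫ z, ((h - g) z.1) ^ 2 ∂ρ := integral_nonneg fun z => sq_nonneg _
  exact le_add_of_nonneg_right (by positivity)

theorem NormalEquations.eq_of_isSolution [IsProbabilityMeasure ρ]
    (hk : Measurable fun p : 𝒳 × 𝒳 => k p.1 p.2) {B : ℝ} (hB : ∀ x y, |k x y| ≤ B)
    (hρ : MemLp (fun z : 𝒳 × ℝ => z.2) 2 ρ) {lam : ℝ} (hlam : 0 < lam) {g h : k.Space}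
    (hg : NormalEquations k ρ lam g) (hh : IsSolution k ρ lam h) : h = g := by
  have h1 := hh g
  rw [hg.objective_eq hk hB hρ h] at h1
  have h2 : 0 ≤ ∫ z, ((h - g) z.1) ^ 2 ∂ρ := integral_nonneg fun z => sq_nonneg _
  have h3 : lam * ‖h - g‖ ^ 2 ≤ 0 := by linarith
  have h4 : ‖h - g‖ ^ 2 ≤ 0 := nonpos_of_mul_nonpos_right h3 hlam
  have h5 : ‖h - g‖ = 0 := pow_eq_zero_iff two_ne_zero |>.1 (le_antisymm h4 (sq_nonneg _))
  exact sub_eq_zero.1 (norm_eq_zero.1 h5)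

/-- No differentiation is needed: uniqueness identifies any minimizer with the Lax–Milgram solution.
-/
theorem IsSolution.normalEquations [IsProbabilityMeasure ρ]
    (hk : Measurable fun p : 𝒳 × 𝒳 => k p.1 p.2) {B : ℝ} (hB : ∀ x y, |k x y| ≤ B)
    (hρ : MemLp (fun z : 𝒳 × ℝ => z.2) 2 ρ) {lam : ℝ} (hlam : 0 < lam) {g : k.Space}
    (hg : IsSolution k ρ lam g) : NormalEquations k ρ lam g := by
  obtain ⟨g', hg'⟩ := exists_normalEquations hk hB hρ hlam
  rwa [hg'.eq_of_isSolution hk hB hρ hlam hg]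

theorem existsUnique_isSolution [IsProbabilityMeasure ρ]
    (hk : Measurable fun p : 𝒳 × 𝒳 => k p.1 p.2) {B : ℝ} (hB : ∀ x y, |k x y| ≤ B)
    (hρ : MemLp (fun z : 𝒳 × ℝ => z.2) 2 ρ) {lam : ℝ} (hlam : 0 < lam) :
    ∃! g : k.Space, IsSolution k ρ lam g := by
  obtain ⟨g, hg⟩ := exists_normalEquations hk hB hρ hlam
  exact ⟨g, hg.isSolution hk hB hρ hlam, fun h hh => hg.eq_of_isSolution hk hB hρ hlam hh⟩

end KernelRegression

/-! ### The mean squared error in terms of the joint law. -/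

namespace KernelRegression

theorem integrable_comp_of_hasLaw {Ω S : Type*} [MeasurableSpace Ω] [MeasurableSpace S]
    {μ : Measure Ω} {ν : Measure S} {Z : Ω → S} (hZ : HasLaw Z ν μ) {F : S → ℝ}
    (hF : Integrable F ν) :
    Integrable (fun ω => F (Z ω)) μ ∧ ∫ ω, F (Z ω) ∂μ = ∫ z, F z ∂ν := by
  refine ⟨?_, hZ.integral_comp hF.aestronglyMeasurable⟩
  rw [← hZ.map_eq] at hF
  exact hF.comp_aemeasurable hZ.aemeasurable

theorem norm_sub_auxEstimator_sq {𝒳 : Type*} {k : PDKernel 𝒳} (lam : ℝ) (g : k.Space)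
    {n : ℕ} (x : Fin n → 𝒳) (y : Fin n → ℝ) :
    ‖g - auxEstimator k lam g x y‖ ^ 2 =
      ‖g‖ ^ 2 - 2 / (n * lam) * ∑ j, (y j - g (x j)) * g (x j) +
        1 / (n ^ 2 * lam ^ 2) *
          ∑ i, ∑ j, (y i - g (x i)) * (y j - g (x j)) * k (x i) (x j) := by
  rw [auxEstimator, PDKernel.norm_sub_smul_sum_section_sq]
  simp only [Finset.mul_sum]
  congr 1
  · congr 1
    refine Finset.sum_congr rfl fun j _ => ?_
    simp only [div_eq_mul_inv, mul_inv]
    ring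
  · refine Finset.sum_congr rfl fun i _ => Finset.sum_congr rfl fun j _ => ?_
    simp only [div_eq_mul_inv, mul_inv]
    ring

variable {𝒳 : Type*} [MeasurableSpace 𝒳] {k : PDKernel 𝒳} {ρ : Measure (𝒳 × ℝ)}

theorem memLp_residual [IsProbabilityMeasure ρ]
    (hk : Measurable fun p : 𝒳 × 𝒳 => k p.1 p.2) {B : ℝ} (hB : ∀ x y, |k x y| ≤ B)
    (hρ : MemLp (fun z : 𝒳 × ℝ => z.2) 2 ρ) (g : k.Space) :
    MemLp (fun z : 𝒳 × ℝ => z.2 - g z.1) 2 ρ :=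
  hρ.sub (memLp_apply_fst hk hB g)

theorem measurable_diag (hk : Measurable fun p : 𝒳 × 𝒳 => k p.1 p.2) :
    Measurable fun x => k x x :=
  hk.comp (measurable_id.prodMk measurable_id)

theorem integrable_residual_sq_mul_diag [IsProbabilityMeasure ρ]
    (hk : Measurable fun p : 𝒳 × 𝒳 => k p.1 p.2) {B : ℝ} (hB : ∀ x y, |k x y| ≤ B)
    (hρ : MemLp (fun z : 𝒳 × ℝ => z.2) 2 ρ) (g : k.Space) :
    Integrable (fun z : 𝒳 × ℝ => (z.2 - g z.1) ^ 2 * k z.1 z.1) ρ :=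
  (memLp_residual hk hB hρ g).integrable_sq.mul_bdd
    ((measurable_diag hk).comp measurable_fst).aestronglyMeasurable
    (ae_of_all _ fun z => hB z.1 z.1)

/-- The second moment of two independent summands of the auxiliary estimator. -/
theorem NormalEquations.integrable_prod [IsProbabilityMeasure ρ]
    (hk : Measurable fun p : 𝒳 × 𝒳 => k p.1 p.2) {B : ℝ} (hB : ∀ x y, |k x y| ≤ B)
    (hρ : MemLp (fun z : 𝒳 × ℝ => z.2) 2 ρ) {lam : ℝ} {g : k.Space}
    (hg : NormalEquations k ρ lam g) :
    Integrable (fun p : (𝒳 × ℝ) × 𝒳 × ℝ =>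
      (p.1.2 - g p.1.1) * (p.2.2 - g p.2.1) * k p.1.1 p.2.1) (ρ.prod ρ) ∧
    ∫ p : (𝒳 × ℝ) × 𝒳 × ℝ,
      (p.1.2 - g p.1.1) * (p.2.2 - g p.2.1) * k p.1.1 p.2.1 ∂(ρ.prod ρ) = lam ^ 2 * ‖g‖ ^ 2 := by
  have hr := (memLp_residual hk hB hρ g).integrable one_le_two
  have hI : Integrable (fun p : (𝒳 × ℝ) × 𝒳 × ℝ =>
      (p.1.2 - g p.1.1) * (p.2.2 - g p.2.1) * k p.1.1 p.2.1) (ρ.prod ρ) :=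
    (hr.mul_prod hr).mul_bdd
      (hk.comp ((measurable_fst.comp measurable_fst).prodMk
        (measurable_fst.comp measurable_snd))).aestronglyMeasurable
      (ae_of_all _ fun p => hB p.1.1 p.2.1)
  refine ⟨hI, ?_⟩
  rw [integral_prod _ hI]
  have h1 : ∀ z : 𝒳 × ℝ, ∫ z' : 𝒳 × ℝ, (z.2 - g z.1) * (z'.2 - g z'.1) * k z.1 z'.1 ∂ρ =
      lam * ((z.2 - g z.1) * g z.1) := by
    intro z
    -- Testing on a section evaluates the inner integral as `lam * g z.1`; testing on `g` then gives
    -- the outer one.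
    have h2 := hg (k.section_ z.1)
    rw [real_inner_comm, PDKernel.inner_section] at h2
    simp only [mul_assoc]
    rw [integral_const_mul, mul_left_comm lam, ← h2]
    congr 2 with z'
    rw [PDKernel.section_apply, k.symm]
  simp only [h1]
  rw [integral_const_mul, hg g, real_inner_self_eq_norm_sq]
  ring

/-- The mean squared error of the auxiliary estimator, in terms of the joint law. -/
theorem NormalEquations.integral_norm_sub_auxEstimator_sq [IsProbabilityMeasure ρ]
    (hk : Measurable fun p : 𝒳 × 𝒳 => k p.1 p.2) {B : ℝ} (hB : ∀ x y, |k x y| ≤ B)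
    (hρ : MemLp (fun z : 𝒳 × ℝ => z.2) 2 ρ) {lam : ℝ} (hlam : 0 < lam) {g : k.Space}
    (hg : NormalEquations k ρ lam g) {n : ℕ} (hn : 1 ≤ n)
    {Ω : Type*} [MeasurableSpace Ω] {μ : Measure Ω} [IsProbabilityMeasure μ]
    {X : Fin n → Ω → 𝒳} {f : Fin n → Ω → ℝ}
    (hlaw : ∀ i, HasLaw (fun ω => (X i ω, f i ω)) ρ μ)
    (hind : iIndepFun (fun i ω => (X i ω, f i ω)) μ) :
    Integrable (fun ω => ‖g - auxEstimator k lam g (fun j => X j ω) (fun j => f j ω)‖ ^ 2) μ ∧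
    ∫ ω, ‖g - auxEstimator k lam g (fun j => X j ω) (fun j => f j ω)‖ ^ 2 ∂μ =
      1 / (lam ^ 2 * n) * (∫ z, (z.2 - g z.1) ^ 2 * k z.1 z.1 ∂ρ) - 1 / n * ‖g‖ ^ 2 := by
  set V := ∫ z, (z.2 - g z.1) ^ 2 * k z.1 z.1 ∂ρ with hV
  have h1 : ∀ j, Integrable (fun ω => (f j ω - g (X j ω)) * g (X j ω)) μ ∧
      ∫ ω, (f j ω - g (X j ω)) * g (X j ω) ∂μ = lam * ‖g‖ ^ 2 := fun j => by
    have := integrable_comp_of_hasLaw (hlaw j)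
      ((memLp_residual hk hB hρ g).integrable_mul (memLp_apply_fst hk hB g))
    refine ⟨this.1, this.2.trans ?_⟩
    rw [← real_inner_self_eq_norm_sq, ← hg g]
    rfl
  -- The off-diagonal value serves as baseline with a correction on the diagonal, so the double sum
  -- counts `n²` baselines and `n` corrections.
  have h2 : ∀ i j,
      Integrable (fun ω => (f i ω - g (X i ω)) * (f j ω - g (X j ω)) * k (X i ω) (X j ω)) μ ∧
      ∫ ω, (f i ω - g (X i ω)) * (f j ω - g (X j ω)) * k (X i ω) (X j ω) ∂μ =
        lam ^ 2 * ‖g‖ ^ 2 + if i = j then V - lam ^ 2 * ‖g‖ ^ 2 else 0 := fun i j => by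
    by_cases hij : i = j
    · subst hij
      have := integrable_comp_of_hasLaw (hlaw i) (integrable_residual_sq_mul_diag hk hB hρ g)
      simpa [← sq, hV] using this
    · have hI := hg.integrable_prod hk hB hρ
      have := integrable_comp_of_hasLaw
        ((hind.indepFun hij).hasLaw_prod (hlaw i) (hlaw j)) hI.1
      refine ⟨this.1, this.2.trans ?_⟩
      rw [hI.2, if_neg hij, add_zero]
  have hS1 : Integrable (fun ω => 2 / (n * lam) * ∑ j, (f j ω - g (X j ω)) * g (X j ω)) μ :=
    (integrable_finsetSum _ fun j _ => (h1 j).1).const_mul _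
  have hS2 : Integrable (fun ω => 1 / (n ^ 2 * lam ^ 2) * ∑ i, ∑ j,
      (f i ω - g (X i ω)) * (f j ω - g (X j ω)) * k (X i ω) (X j ω)) μ :=
    (integrable_finsetSum _ fun i _ => integrable_finsetSum _ fun j _ => (h2 i j).1).const_mul _
  have hS0 : Integrable (fun ω => ‖g‖ ^ 2 -
      2 / (n * lam) * ∑ j, (f j ω - g (X j ω)) * g (X j ω)) μ := (integrable_const _).sub hS1
  simp only [norm_sub_auxEstimator_sq]
  refine ⟨hS0.add hS2, ?_⟩
  rw [integral_add hS0 hS2, integral_sub (integrable_const _) hS1, integral_const_mul,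
    integral_const_mul, integral_finsetSum _ fun j _ => (h1 j).1,
    integral_finsetSum _ fun i _ => integrable_finsetSum _ fun j _ => (h2 i j).1]
  simp only [integral_finsetSum _ fun j _ => (h2 _ j).1, (h1 _).2, (h2 _ _).2,
    Finset.sum_add_distrib, Finset.sum_ite_eq, Finset.mem_univ, if_true, Finset.sum_const,
    Finset.card_univ, Fintype.card_fin, nsmul_eq_mul, integral_const, probReal_univ, smul_eq_mul]
  have hn' : (n : ℝ) ≠ 0 := by positivity
  field_simp
  ring

/-! ### Conditioning on `X`, and bounds for the constant. -/

/-- Disintegration of the residual against a test function. -/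
theorem integral_condMean_sub_mul [IsProbabilityMeasure ρ]
    (hk : Measurable fun p : 𝒳 × 𝒳 => k p.1 p.2) {B : ℝ} (hB : ∀ x y, |k x y| ≤ B)
    (hρ : MemLp (fun z : 𝒳 × ℝ => z.2) 2 ρ) (g h : k.Space) :
    Integrable (fun x => (condMean ρ x - g x) * h x) (design ρ) ∧
    ∫ x, (condMean ρ x - g x) * h x ∂(design ρ) = ∫ z, (z.2 - g z.1) * h z.1 ∂ρ := by
  have hI := (memLp_residual hk hB hρ g).integrable_mul (memLp_apply_fst hk hB h)
  have hae : (fun x => ∫ y, (y - g x) * h x ∂(ρ.condKernel x)) =ᵐ[design ρ]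
      fun x => (condMean ρ x - g x) * h x := by
    filter_upwards [(hρ.integrable one_le_two).condKernel_ae] with x hx
    rw [integral_mul_const, integral_sub hx (integrable_const _)]
    simp [condMean]
  exact ⟨hI.integral_condKernel.congr hae,
    (integral_congr_ae hae).symm.trans (Measure.integral_condKernel hI)⟩

/-- Bias-variance decomposition of the residual, weighted by the diagonal of the kernel. -/
theorem integral_condVar_add_sq_mul_diag [IsProbabilityMeasure ρ]
    (hk : Measurable fun p : 𝒳 × 𝒳 => k p.1 p.2) {B : ℝ} (hB : ∀ x y, |k x y| ≤ B)
    (hρ : MemLp (fun z : 𝒳 × ℝ => z.2) 2 ρ) (g : k.Space) :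
    Integrable (fun x => (condVar ρ x + (condMean ρ x - g x) ^ 2) * k x x) (design ρ) ∧
    ∫ x, (condVar ρ x + (condMean ρ x - g x) ^ 2) * k x x ∂(design ρ) =
      ∫ z, (z.2 - g z.1) ^ 2 * k z.1 z.1 ∂ρ := by
  have hI := integrable_residual_sq_mul_diag hk hB hρ g
  have hae : (fun x => ∫ y, (y - g x) ^ 2 * k x x ∂(ρ.condKernel x)) =ᵐ[design ρ]
      fun x => (condVar ρ x + (condMean ρ x - g x) ^ 2) * k x x := by
    filter_upwards [(hρ.integrable one_le_two).condKernel_ae, hρ.integrable_sq.condKernel_ae]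
      with x hx hx2
    rw [integral_mul_const]
    congr 1
    have hc : Integrable (fun y => 2 * (condMean ρ x - g x) * (y - condMean ρ x))
        (ρ.condKernel x) := (hx.sub (integrable_const _)).const_mul _
    have hs : Integrable (fun y => (y - condMean ρ x) ^ 2) (ρ.condKernel x) := by
      have : (fun y : ℝ => (y - condMean ρ x) ^ 2) =
          fun y => y ^ 2 - 2 * condMean ρ x * y + condMean ρ x ^ 2 := by ext y; ring
      rw [this]
      exact (hx2.sub (hx.const_mul _)).add (integrable_const _)
    have h0 : ∫ y, (y - condMean ρ x) ∂(ρ.condKernel x) = 0 := by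
      rw [integral_sub hx (integrable_const _)]
      simp [condMean]
    have he : ∀ y : ℝ, (y - g x) ^ 2 = (y - condMean ρ x) ^ 2 +
        2 * (condMean ρ x - g x) * (y - condMean ρ x) + (condMean ρ x - g x) ^ 2 :=
      fun y => by ring
    rw [integral_congr_ae (ae_of_all _ he), integral_add (f := fun y => (y - condMean ρ x) ^ 2 +
        2 * (condMean ρ x - g x) * (y - condMean ρ x)) (hs.add hc) (integrable_const _),
      integral_add hs hc, integral_const_mul, h0]
    simp [condVar]
  exact ⟨hI.integral_condKernel.congr hae,
    (integral_congr_ae hae).symm.trans (Measure.integral_condKernel hI)⟩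

theorem condVar_nonneg [IsFiniteMeasure ρ] (x : 𝒳) : 0 ≤ condVar ρ x :=
  integral_nonneg fun _ => sq_nonneg _

theorem integrable_condMean_sub_sq_mul_diag [IsProbabilityMeasure ρ]
    (hk : Measurable fun p : 𝒳 × 𝒳 => k p.1 p.2) {B : ℝ} (hB : ∀ x y, |k x y| ≤ B)
    (hρ : MemLp (fun z : 𝒳 × ℝ => z.2) 2 ρ) (g : k.Space) :
    Integrable (fun x => (condMean ρ x - g x) ^ 2 * k x x) (design ρ) := by
  have hm : AEStronglyMeasurable (condMean ρ) (design ρ) :=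
    (hρ.integrable one_le_two).integral_condKernel.aestronglyMeasurable
  refine (integral_condVar_add_sq_mul_diag hk hB hρ g).1.mono
    (((hm.sub (k.measurable_coe hk g).aestronglyMeasurable).pow 2).mul
      (measurable_diag hk).aestronglyMeasurable) (ae_of_all _ fun x => ?_)
  have h1 := condVar_nonneg (ρ := ρ) x
  have h2 := k.diag_nonneg x
  rw [Real.norm_of_nonneg (by positivity), Real.norm_of_nonneg (by positivity)]
  gcongr
  exact le_add_of_nonneg_left h1

/-- The squared bias, weighted by the diagonal of the kernel, dominates `lam² ‖g‖²`. -/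
theorem NormalEquations.sq_mul_norm_sq_le [IsProbabilityMeasure ρ]
    (hk : Measurable fun p : 𝒳 × 𝒳 => k p.1 p.2) {B : ℝ} (hB : ∀ x y, |k x y| ≤ B)
    (hρ : MemLp (fun z : 𝒳 × ℝ => z.2) 2 ρ) {lam : ℝ} {g : k.Space}
    (hg : NormalEquations k ρ lam g) :
    lam ^ 2 * ‖g‖ ^ 2 ≤ ∫ x, (condMean ρ x - g x) ^ 2 * k x x ∂(design ρ) := by
  have : IsProbabilityMeasure (design ρ) := inferInstanceAs (IsProbabilityMeasure ρ.fst)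
  obtain ⟨h1, h2⟩ := integral_condMean_sub_mul hk hB hρ g g
  have h3 := integrable_condMean_sub_sq_mul_diag hk hB hρ g
  have h4 : ∫ x, 2 * lam * ((condMean ρ x - g x) * g x) ∂(design ρ) ≤
      ∫ x, ((condMean ρ x - g x) ^ 2 * k x x + lam ^ 2 * ‖g‖ ^ 2) ∂(design ρ) := by
    refine integral_mono (h1.const_mul _) (h3.add (integrable_const _)) fun x => ?_
    -- Jensen's inequality in pointwise form: `lam • g` is the mean of the vectors `(f₀(x) - g x)
    -- k(·, x)`.
    have h5 := sq_nonneg ‖(condMean ρ x - g x) • k.section_ x - lam • g‖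
    rw [norm_sub_sq_real, norm_smul, norm_smul, mul_pow, mul_pow, PDKernel.norm_section_sq,
      real_inner_smul_left, inner_smul_right, PDKernel.inner_section, Real.norm_eq_abs,
      Real.norm_eq_abs, sq_abs, sq_abs] at h5
    dsimp only
    linarith
  rw [integral_const_mul, h2, hg g, real_inner_self_eq_norm_sq,
    integral_add h3 (integrable_const _), integral_const, probReal_univ, one_smul] at h4
  linarith

theorem NormalEquations.integral_condVar_mul_diag_le [IsProbabilityMeasure ρ]
    (hk : Measurable fun p : 𝒳 × 𝒳 => k p.1 p.2) {B : ℝ} (hB : ∀ x y, |k x y| ≤ B)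
    (hρ : MemLp (fun z : 𝒳 × ℝ => z.2) 2 ρ) {lam : ℝ} {g : k.Space}
    (hg : NormalEquations k ρ lam g) :
    ∫ x, condVar ρ x * k x x ∂(design ρ) ≤
      (∫ x, (condVar ρ x + (condMean ρ x - g x) ^ 2) * k x x ∂(design ρ)) -
        lam ^ 2 * ‖g‖ ^ 2 := by
  have h1 := (integral_condVar_add_sq_mul_diag hk hB hρ g).1
  have h2 := integrable_condMean_sub_sq_mul_diag hk hB hρ g
  -- As a difference of two functions already known to be integrable, the variance term can be
  -- integrated by linearity.
  have h3 : ∀ x, condVar ρ x * k x x = (condVar ρ x + (condMean ρ x - g x) ^ 2) * k x x -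
      (condMean ρ x - g x) ^ 2 * k x x := fun x => by ring
  rw [integral_congr_ae (ae_of_all _ h3), integral_sub h1 h2]
  linarith [hg.sq_mul_norm_sq_le hk hB hρ]

theorem IsSolution.integral_condVar_add_sq_mul_diag_le [IsProbabilityMeasure ρ]
    (hk : Measurable fun p : 𝒳 × 𝒳 => k p.1 p.2) {B : ℝ} (hB : ∀ x y, |k x y| ≤ B)
    (hρ : MemLp (fun z : 𝒳 × ℝ => z.2) 2 ρ) {lam : ℝ} (hlam : 0 < lam) {g : k.Space}
    (hg : IsSolution k ρ lam g) :
    ∫ x, (condVar ρ x + (condMean ρ x - g x) ^ 2) * k x x ∂(design ρ) ≤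
      B * ∫ z, z.2 ^ 2 ∂ρ := by
  obtain ⟨z₀⟩ : Nonempty (𝒳 × ℝ) := nonempty_of_isProbabilityMeasure ρ
  have hB0 : 0 ≤ B := (abs_nonneg _).trans (hB z₀.1 z₀.1)
  rw [(integral_condVar_add_sq_mul_diag hk hB hρ g).2]
  have h1 : ∫ z, (z.2 - g z.1) ^ 2 * k z.1 z.1 ∂ρ ≤ ∫ z, B * (z.2 - g z.1) ^ 2 ∂ρ := by
    refine integral_mono (integrable_residual_sq_mul_diag hk hB hρ g)
      ((memLp_residual hk hB hρ g).integrable_sq.const_mul B) fun z => ?_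
    dsimp only
    rw [mul_comm]
    gcongr
    exact (le_abs_self _).trans (hB _ _)
  -- The objective at zero is `E f²`, a bound on the residual uniform in `lam`.
  have h2 := hg 0
  simp only [objective, RKHS.coe_zero, Pi.zero_apply, sub_zero, norm_zero] at h2
  rw [integral_const_mul] at h1
  refine h1.trans (mul_le_mul_of_nonneg_left ?_ hB0)
  have h3 : 0 ≤ lam * ‖g‖ ^ 2 := by positivity
  linarith

end KernelRegression

theorem mainTheorem4 {𝒳 : Type*} [MeasurableSpace 𝒳]
    (k : PDKernel 𝒳)
    (hk_meas : Measurable (fun p : 𝒳 × 𝒳 => k p.1 p.2))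
    (hk_bdd : ∃ B : ℝ, ∀ x y, |k x y| ≤ B)
    (ρ : Measure (𝒳 × ℝ)) [IsProbabilityMeasure ρ]
    (hρ : MemLp (fun z : 𝒳 × ℝ => z.2) 2 ρ) :
    -- the solution of the continuous problem exists and is unique
    (∀ lam : ℝ, 0 < lam → ∃! g : k.Space, KernelRegression.IsSolution k ρ lam g) ∧
    ∃ (C₁ : ℝ → ℝ) (C : ℝ), 0 < C ∧
      (∀ lam : ℝ, 0 < lam →
        ∫ x, KernelRegression.condVar ρ x * k x x ∂(KernelRegression.design ρ) ≤ C₁ lam ∧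
        C₁ lam ≤ C) ∧
      ∀ lam : ℝ, 0 < lam →
      ∀ flam : k.Space, KernelRegression.IsSolution k ρ lam flam →
      ∀ n : ℕ, 1 ≤ n →
      ∀ {Ω : Type*} [MeasurableSpace Ω] (μ : Measure Ω) [IsProbabilityMeasure μ]
        (X : Fin n → Ω → 𝒳) (f : Fin n → Ω → ℝ),
        (∀ i, HasLaw (fun ω => (X i ω, f i ω)) ρ μ) →
        iIndepFun (fun i ω => (X i ω, f i ω)) μ →
        Integrable (fun ω => ‖flam -
          KernelRegression.auxEstimator k lam flam (fun j => X j ω) (fun j => f j ω)‖ ^ 2) μ ∧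
        (∫ ω, ‖flam -
          KernelRegression.auxEstimator k lam flam (fun j => X j ω) (fun j => f j ω)‖ ^ 2 ∂μ) =
          1 / (lam ^ 2 * n) *
            (∫ x, (KernelRegression.condVar ρ x + (KernelRegression.condMean ρ x - flam x) ^ 2)
              * k x x ∂(KernelRegression.design ρ))
            - 1 / n * ‖flam‖ ^ 2 ∧
        (∫ ω, ‖flam -
          KernelRegression.auxEstimator k lam flam (fun j => X j ω) (fun j => f j ω)‖ ^ 2 ∂μ) =
          C₁ lam / (lam ^ 2 * n) := by
  obtain ⟨B, hB⟩ := hk_bdd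
  have hex := fun lam (hlam : 0 < lam) =>
    KernelRegression.existsUnique_isSolution (lam := lam) hk_meas hB hρ hlam
  refine ⟨hex, fun lam => if hlam : 0 < lam then
      (∫ x, (KernelRegression.condVar ρ x +
          (KernelRegression.condMean ρ x - (hex lam hlam).choose x) ^ 2) * k x x
        ∂(KernelRegression.design ρ)) - lam ^ 2 * ‖(hex lam hlam).choose‖ ^ 2
      else 0, |B| * (∫ z, z.2 ^ 2 ∂ρ) + 1, ?_, fun lam hlam => ?_, ?_⟩
  · have : 0 ≤ ∫ z, z.2 ^ 2 ∂ρ := integral_nonneg fun z => sq_nonneg _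
    positivity
  · have hsol := (hex lam hlam).choose_spec.1
    simp only [dif_pos hlam]
    refine ⟨(hsol.normalEquations hk_meas hB hρ hlam).integral_condVar_mul_diag_le hk_meas hB hρ,
      ?_⟩
    have h1 := hsol.integral_condVar_add_sq_mul_diag_le hk_meas
      (fun x y => (hB x y).trans (le_abs_self B)) hρ hlam
    have h2 : 0 ≤ lam ^ 2 * ‖(hex lam hlam).choose‖ ^ 2 := by positivity
    linarith
  · intro lam hlam flam hflam n hn Ω _ μ _ X f hlaw hind
    -- Uniqueness makes the chosen minimizer in `C₁` the given one.
    have hflam' : (hex lam hlam).choose = flam :=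
      ((hex lam hlam).choose_spec.2 flam hflam).symm
    obtain ⟨hint, heq⟩ :=
      (hflam.normalEquations hk_meas hB hρ hlam).integral_norm_sub_auxEstimator_sq
      hk_meas hB hρ hlam hn hlaw hind
    rw [← (KernelRegression.integral_condVar_add_sq_mul_diag hk_meas hB hρ flam).2] at heq
    refine ⟨hint, heq, heq.trans ?_⟩
    simp only [dif_pos hlam, hflam']
    have hn' : (n : ℝ) ≠ 0 := by positivity
    field_simp
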